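/- Let $\mathcal A$ be an alphabet with $d\ge 11$ letters and let $\mathbf v=v_0v_1v_2\cdots$ be an infinite sequence over $\mathcal A$. A factor of $\mathbf v$ is a word of the form $v_iv_{i+1}\cdots v_{j-1}$ with $0\le i\le j$. For a word $w$, write $|w|$ for its length and $|w|_a$ for the number of occurrences of the letter $a$ in $w$. The sequence $\mathbf v$ is balanced if $|u|_a-|w|_a\le 1$ for every letter $a\in\mathcal A$ and all factors $u,w$ of $\mathbf v$ with $|u|=|w|$. The exponent of a nonempty word $z$ is $\exp(z)=|z|/|u|$, where $u$ is the shortest nonempty word such that $z$ is a prefix of $u^\omega=uuu\cdots$, and the critical exponent of $\mathbf v$ is $$\mathrm E(\mathbf v)=\sup\{\exp(z): z \text{ is a nonempty factor of } \mathbf v\}\in[1,+\infty].$$ Suppose that $\mathbf v$ is balanced and that $\mathrm E(\mathbf v)=\frac{d-1}{d-2}$. Then every letter $a\in\mathcal A$ has a frequency $$\rho_a=\lim_{n\to\infty}\frac{|v_0v_1\cdots v_{n-1}|_a}{n}$$ in $\mathbf v$ (that is, the limit exists), and the maximum letter frequency $\rho=\max_{a\in\mathcal A}\rho_a$ satisfies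 $$\frac1{d-1}<\rho<\frac1{d-2}.$$ -/

import Mathlib

namespace InfWord

variable {α : Type*}

/-- The word `v i, v (i+1), …, v (i+n-1)` read in the sequence `v` at position `i`. -/
def window (v : ℕ → α) (i n : ℕ) : List α :=
  (List.range n).map fun k => v (i + k)

/-- `w` is a (possibly empty) factor of the infinite sequence `v`. -/
def IsFactor (v : ℕ → α) (w : List α) : Prop :=
  ∃ i n : ℕ, w = window v i n

/-- `v` is balanced: in two factors of equal length, the numbers of occurrences of each letter
differ by at most `1` (the pair is ordered, so this is a bound on the absolute difference). -/
def IsBalanced [DecidableEq α] (v : ℕ → α) : Prop :=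
  ∀ (a : α) (u w : List α), IsFactor v u → IsFactor v w → u.length = w.length →
    u.count a ≤ w.count a + 1

/-- `z` is a prefix of the periodic sequence `uuu⋯`, where `u` is a nonempty word. -/
def IsPrefixOfOmegaPower (z u : List α) : Prop :=
  u ≠ [] ∧ ∀ i < z.length, z[i]? = u[i % u.length]?

/-- The minimal period of a nonempty word `z`: the length of the shortest nonempty word `u`
such that `z` is a prefix of `uuu⋯`. -/
noncomputable def minPeriod (z : List α) : ℕ :=
  sInf {p : ℕ | ∃ u : List α, u.length = p ∧ IsPrefixOfOmegaPower z u}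

/-- The exponent of a nonempty word `z`: its length divided by its minimal period. -/
noncomputable def wordExp (z : List α) : ℝ :=
  (z.length : ℝ) / (minPeriod z : ℝ)

/-- The critical exponent of `v`: the supremum, possibly `+∞`, of the exponents of the
nonempty factors of `v`. -/
noncomputable def critExp (v : ℕ → α) : EReal :=
  ⨆ z ∈ {z : List α | z ≠ [] ∧ IsFactor v z}, (wordExp z : EReal)

/-- The letter `a` has frequency `r` in `v`. -/
def HasLetterFreq [DecidableEq α] (v : ℕ → α) (a : α) (r : ℝ) : Prop :=
  Filter.Tendsto (fun n : ℕ => ((window v 0 n).count a : ℝ) / (n : ℝ)) Filter.atTop (nhds r)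

end InfWord

/-!
In a balanced sequence the count of a letter of frequency `θ` stays within `1` of `nθ` on every
window of length `n`. If `θ` is rational, this forces the occurrences of the letter to be
eventually periodic; if some arithmetic progression carries a single letter, it forces every
frequency to be rational, because an irrational rotation would spread the discrepancies along the
progression too widely. Hence a balanced sequence constant along a progression is eventually
periodic, which a finite critical exponent excludes, and positive frequencies are irrational.

Put `m = d - 2`. Critical exponent at most `(m + 1) / m` makes any `m` consecutive letters
distinct, so frequencies are at most `1 / m`. If some letter recurs at distance exactly `m`,
balance puts it in every window of length `m + 1`, so its frequency is at least `1 / (m + 1)`.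
Otherwise any `m + 1` consecutive letters are distinct, each letter recurs after `m + 1`, `m + 2`
or `m + 3` steps, and no letter uses both `m + 1` and `m + 3`. Tracking which letters ever use
the short distance `m + 1` then produces a constant progression, a contradiction. Irrationality
makes the bounds strict.
-/

open Filter Finset

theorem exists_lt_abs_sub_of_denseRange_coe {ι : Type*} {E : ι → ℝ}
    (hE : DenseRange fun i => (E i : UnitAddCircle)) {c : ℝ} (hc : c < 1) :
    ∃ i j, c < |E i - E j| := by
  by_contra! hosc
  have : Nonempty ι := hE.nonempty
  have hbdd : BddBelow (Set.range E) := by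
    obtain ⟨i⟩ := this
    refine ⟨E i - c, ?_⟩
    rintro _ ⟨j, rfl⟩
    linarith [(abs_le.mp (hosc i j)).2]
  set b : ℝ := ⨅ i, E i 
  have hlower (i : ι) : b ≤ E i := ciInf_le hbdd i
  have hupper (i : ι) : E i ≤ b + c := by
    have : E i - c ≤ b := le_ciInf fun j => by linarith [(abs_le.mp (hosc i j)).2]
    linarith
  have hopen : IsOpen (((↑) : ℝ → UnitAddCircle) '' Set.Ioo (b + c) (b + 1)) :=
    QuotientAddGroup.isOpenMap_coe _ isOpen_Ioo
  obtain ⟨i, x, ⟨hx₁, hx₂⟩, hxi⟩ :=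
    hE.exists_mem_open hopen ((Set.nonempty_Ioo.mpr (by linarith)).image _)
  obtain ⟨k, hk⟩ : ∃ k : ℤ, k • (1 : ℝ) = x - E i := by
    rw [← AddCircle.coe_eq_zero_iff, AddCircle.coe_sub, sub_eq_zero]
    exact hxi
  rw [zsmul_one] at hk
  have hk₀ : (0 : ℝ) < k := by linarith [hupper i]
  have hk₁ : (k : ℝ) < 1 := by linarith [hlower i]
  norm_cast at hk₀ hk₁
  lia

theorem eventually_eq_zero_of_nonneg_of_sum_range_le {f : ℕ → ℤ} (hf : ∀ n, 0 ≤ f n) {C : ℤ}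
    (hC : ∀ n, ∑ i ∈ range n, f i ≤ C) : ∀ᶠ n in atTop, f n = 0 := by
  have hsum : Summable fun n => (f n : ℝ) :=
    summable_of_sum_range_le (c := C) (fun n => by exact_mod_cast hf n)
      fun n => by exact_mod_cast hC n
  filter_upwards [hsum.tendsto_atTop_zero.eventually_lt_const one_pos] with n hn
  have : f n < 1 := by exact_mod_cast hn
  linarith [hf n]

theorem eventually_eq_zero_of_abs_sum_range_le {f : ℕ → ℤ} (hf : ∀ i j, f i ≤ f j + 1) {C : ℤ}
    (hC : ∀ n, |∑ i ∈ range n, f i| ≤ C) : ∀ᶠ n in atTop, f n = 0 := by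
  by_cases hneg : ∃ i, f i < 0
  · obtain ⟨i, hi⟩ := hneg
    have hnonpos (n : ℕ) : 0 ≤ -f n := by linarith [hf n i]
    have hsum (n : ℕ) : ∑ i ∈ range n, -f i ≤ C := by
      rw [sum_neg_distrib]
      exact (neg_le_abs _).trans (hC n)
    simpa only [neg_eq_zero] using eventually_eq_zero_of_nonneg_of_sum_range_le hnonpos hsum
  · push Not at hneg
    exact eventually_eq_zero_of_nonneg_of_sum_range_le hneg fun n => (le_abs_self _).trans (hC n)

theorem abs_sum_range_shift_sub_le {D : ℕ → ℝ} {c : ℝ} (hD : ∀ i j, |D i - D j| ≤ c) (q n : ℕ) :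
    |∑ i ∈ range n, (D (q + i) - D i)| ≤ q * c := by
  have hswap : ∑ i ∈ range n, (D (q + i) - D i) = ∑ i ∈ range q, (D (n + i) - D i) := by
    have hqn := sum_range_add D q n
    rw [add_comm q n, sum_range_add D n q] at hqn
    rw [sum_sub_distrib, sum_sub_distrib]
    linarith
  calc |∑ i ∈ range n, (D (q + i) - D i)|
      ≤ ∑ i ∈ range q, |D (n + i) - D i| := hswap ▸ abs_sum_le_sum_abs _ _
    _ ≤ ∑ _i ∈ range q, c := sum_le_sum fun i _ => hD _ _
    _ = q * c := by simp

theorem mem_of_nodup_of_card_le_length {α : Type*} [Fintype α] {l : List α} (hl : l.Nodup)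
    (hcard : Fintype.card α ≤ l.length) (x : α) : x ∈ l := by
  by_contra hx
  have := (List.nodup_cons.mpr ⟨hx, hl⟩).length_le_card
  rw [List.length_cons] at this
  lia

namespace InfWord

variable {α : Type*} {v : ℕ → α}

/-! ### Windows -/

@[simp]
theorem length_window (v : ℕ → α) (i n : ℕ) : (window v i n).length = n := by
  simp [window]

theorem window_add (v : ℕ → α) (i m n : ℕ) :
    window v i (m + n) = window v i m ++ window v (i + m) n := by
  simp [window, List.range_add, Function.comp_def, add_assoc]

@[simp]
theorem window_one (v : ℕ → α) (i : ℕ) : window v i 1 = [v i] := by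
  simp [window]

theorem window_succ (v : ℕ → α) (i n : ℕ) :
    window v i (n + 1) = v i :: window v (i + 1) n := by
  rw [add_comm n, window_add, window_one, List.singleton_append]

theorem window_succ_right (v : ℕ → α) (i n : ℕ) :
    window v i (n + 1) = window v i n ++ [v (i + n)] := by
  rw [window_add, window_one]

theorem mem_window {i n : ℕ} {x : α} : x ∈ window v i n ↔ ∃ k < n, v (i + k) = x := by
  simp [window]

theorem window_eq_window_iff {i j n : ℕ} :
    window v i n = window v j n ↔ ∀ t < n, v (i + t) = v (j + t) := by
  simp [window]

theorem isFactor_window (v : ℕ → α) (i n : ℕ) : IsFactor v (window v i n) := ⟨i, n, rfl⟩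

/-- Any `n` consecutive letters of `v` are pairwise distinct. -/
def DistinctWithin (v : ℕ → α) (n : ℕ) : Prop :=
  ∀ ⦃i j⦄, i < j → j < i + n → v i ≠ v j

theorem DistinctWithin.nodup_window {n : ℕ} (h : DistinctWithin v n) (i : ℕ) :
    (window v i n).Nodup := by
  refine List.pairwise_map.mpr (List.pairwise_lt_range.imp_of_mem fun _ hk hjk => ?_)
  have := List.mem_range.mp hk
  exact h (by lia) (by lia)

/-- The letter `x` occurs at two positions of `v` at distance `g`. -/
def RecursAt (v : ℕ → α) (g : ℕ) (x : α) : Prop :=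
  ∃ i, v i = x ∧ v (i + g) = x

/-! ### Critical exponent and repetitions -/

theorem apply_add_mod_of_repetition {i p n : ℕ} (h : window v i n = window v (i + p) n) {k : ℕ}
    (hk : k < p + n) : v (i + k % p) = v (i + k) := by
  rcases p.eq_zero_or_pos with rfl | hp
  · rw [Nat.mod_zero]
  induction k using Nat.strong_induction_on with
  | _ k ih =>
    rcases lt_or_ge k p with hkp | hpk
    · rw [Nat.mod_eq_of_lt hkp]
    · rw [Nat.mod_eq_sub_mod hpk, ih (k - p) (by lia) (by lia),
        window_eq_window_iff.mp h (k - p) (by lia)]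
      congr 1
      lia

theorem minPeriod_window_le {i p n : ℕ} (hp : 0 < p) (h : window v i n = window v (i + p) n) :
    minPeriod (window v i (p + n)) ≤ p := by
  refine Nat.sInf_le ⟨window v i p, length_window v i p, ?_, fun k hk => ?_⟩
  · rw [← List.length_pos_iff, length_window]
    exact hp
  · rw [length_window] at hk ⊢
    simp [window, hk, Nat.mod_lt k hp, apply_add_mod_of_repetition h hk]

theorem minPeriod_pos {z : List α} (hz : z ≠ []) : 0 < minPeriod z := by
  have hne : {p : ℕ | ∃ u : List α, u.length = p ∧ IsPrefixOfOmegaPower z u}.Nonempty :=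
    ⟨z.length, z, rfl, hz, fun i hi => by rw [Nat.mod_eq_of_lt hi]⟩
  obtain ⟨u, hu, hu_ne, -⟩ := Nat.sInf_mem hne
  rw [minPeriod, ← hu]
  exact List.length_pos_iff.mpr hu_ne

theorem le_critExp_of_repetition {i p n : ℕ} (hp : 0 < p)
    (h : window v i n = window v (i + p) n) :
    (((p + n) / p : ℝ) : EReal) ≤ critExp v := by
  have hz : window v i (p + n) ≠ [] := by
    rw [← List.length_pos_iff, length_window]
    lia
  have hexp : ((p + n) / p : ℝ) ≤ wordExp (window v i (p + n)) := by
    rw [wordExp, length_window, Nat.cast_add]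
    exact div_le_div_of_nonneg_left (by positivity) (by exact_mod_cast minPeriod_pos hz)
      (by exact_mod_cast minPeriod_window_le hp h)
  exact (EReal.coe_le_coe_iff.mpr hexp).trans
    (le_iSup₂_of_le (window v i (p + n)) ⟨hz, isFactor_window v i _⟩ le_rfl)

/-- A word of length `n` recurs in `v` only at distances at least `n * m`; for `m > 0` this says
that `v` has critical exponent at most `(m + 1) / m`. -/
def HasSparseRepetitions (v : ℕ → α) (m : ℕ) : Prop :=
  ∀ ⦃i p n⦄, 0 < p → window v i n = window v (i + p) n → n * m ≤ p

theorem hasSparseRepetitions_of_critExp_le {m : ℕ} (hm : 0 < m)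
    (hE : critExp v ≤ (((m + 1) / m : ℝ) : EReal)) : HasSparseRepetitions v m := by
  intro i p n hp h
  have hle : ((p + n) / p : ℝ) ≤ (m + 1) / m :=
    EReal.coe_le_coe_iff.mp ((le_critExp_of_repetition hp h).trans hE)
  rw [div_le_div_iff₀ (by positivity) (by positivity)] at hle
  have : (n * m : ℝ) ≤ p := by linarith
  exact_mod_cast this

theorem HasSparseRepetitions.distinctWithin {m : ℕ} (hv : HasSparseRepetitions v m) :
    DistinctWithin v m := by
  intro i j hij hj h
  have hrep : window v i 1 = window v (i + (j - i)) 1 := by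
    rw [window_one, window_one, h, Nat.add_sub_cancel' hij.le]
  have := hv (by lia) hrep
  lia

theorem HasSparseRepetitions.not_eventually_periodic {m : ℕ} (hv : HasSparseRepetitions v m)
    (hm : 0 < m) {q : ℕ} (hq : 0 < q) : ¬ ∀ᶠ n in atTop, v (n + q) = v n := by
  rw [eventually_atTop]
  rintro ⟨N, hN⟩
  have hrep : window v N (q + 1) = window v (N + q) (q + 1) :=
    window_eq_window_iff.mpr fun t _ => by rw [add_right_comm, hN _ (by lia)]
  have := (Nat.le_mul_of_pos_right (q + 1) hm).trans (hv hq hrep)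
  lia

/-! ### Letter frequencies -/

section Frequency

variable [DecidableEq α] {a : α} {θ : ℝ}

theorem IsBalanced.count_window_le (hbal : IsBalanced v) (a : α) (i j n : ℕ) :
    (window v i n).count a ≤ (window v j n).count a + 1 :=
  hbal a _ _ (isFactor_window v i n) (isFactor_window v j n) (by simp)

theorem IsBalanced.mem_window (hbal : IsBalanced v) {g : ℕ} (hg : 0 < g) {x : α}
    (hx : RecursAt v g x) (j : ℕ) : x ∈ window v j (g + 1) := by
  obtain ⟨i, hi, hig⟩ := hx
  obtain ⟨k, rfl⟩ := Nat.exists_eq_succ_of_ne_zero hg.ne'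
  have htwo : 2 ≤ (window v i (k + 1 + 1)).count x := by
    rw [window_succ_right, window_succ, hi, hig]
    simp
  rw [← List.count_pos_iff]
  have := hbal.count_window_le x i j (k + 1 + 1)
  lia

theorem IsBalanced.exists_hasLetterFreq (hbal : IsBalanced v) (a : α) :
    ∃ θ, HasLetterFreq v a θ := by
  have hsub : Subadditive fun n => ((window v 0 n).count a + 1 : ℝ) := by
    intro m n
    beta_reduce
    have : (window v 0 (m + n)).count a + 1 ≤
        (window v 0 m).count a + 1 + ((window v 0 n).count a + 1) := by
      rw [window_add, List.count_append]
      linarith [hbal.count_window_le a (0 + m) 0 n]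
    exact_mod_cast this
  have hbdd : BddBelow (Set.range fun n : ℕ => ((window v 0 n).count a + 1 : ℝ) / n) := by
    refine ⟨0, ?_⟩
    rintro _ ⟨n, rfl⟩
    positivity
  refine ⟨hsub.lim, ?_⟩
  have hlim := (hsub.tendsto_lim hbdd).sub tendsto_one_div_atTop_nhds_zero_nat
  rw [sub_zero] at hlim
  exact hlim.congr fun n => by ring

theorem HasLetterFreq.tendsto_count_mul (hθ : HasLetterFreq v a θ) {n : ℕ} (hn : 0 < n) :
    Tendsto (fun k : ℕ => ((window v 0 (k * n)).count a : ℝ) / k) atTop (nhds (n * θ)) := by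
  have hsub := (hθ.comp (tendsto_id.atTop_mul_const' hn)).const_mul (n : ℝ)
  refine hsub.congr fun k => ?_
  simp only [Function.comp_apply, id_eq, Nat.cast_mul]
  field_simp

theorem HasLetterFreq.mul_le_of_count_le (hθ : HasLetterFreq v a θ) {n : ℕ} {c : ℝ}
    (h : ∀ i, ((window v i n).count a : ℝ) ≤ c) : n * θ ≤ c := by
  rcases n.eq_zero_or_pos with rfl | hn
  · simpa [window] using h 0
  have hblocks (k : ℕ) : ((window v 0 (k * n)).count a : ℝ) ≤ k * c := by
    induction k with
    | zero => simp [window]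
    | succ k ih =>
      rw [Nat.succ_mul, window_add, List.count_append]
      push_cast
      linarith [h (0 + k * n)]
  refine le_of_tendsto (hθ.tendsto_count_mul hn) ?_
  filter_upwards [eventually_gt_atTop 0] with k hk
  rw [div_le_iff₀' (by positivity)]
  exact hblocks k

theorem HasLetterFreq.le_mul_of_le_count (hθ : HasLetterFreq v a θ) {n : ℕ} {c : ℝ}
    (h : ∀ i, c ≤ ((window v i n).count a : ℝ)) : c ≤ n * θ := by
  rcases n.eq_zero_or_pos with rfl | hn
  · simpa [window] using h 0
  have hblocks (k : ℕ) : k * c ≤ ((window v 0 (k * n)).count a : ℝ) := by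
    induction k with
    | zero => simp [window]
    | succ k ih =>
      rw [Nat.succ_mul, window_add, List.count_append]
      push_cast
      linarith [h (0 + k * n)]
  refine ge_of_tendsto (hθ.tendsto_count_mul hn) ?_
  filter_upwards [eventually_gt_atTop 0] with k hk
  rw [le_div_iff₀' (by positivity)]
  exact hblocks k

theorem HasLetterFreq.frequently_eq (hθ : HasLetterFreq v a θ) (hne : θ ≠ 0) :
    ∃ᶠ n in atTop, v n = a := by
  intro hev
  obtain ⟨N, hN⟩ : ∃ N, ∀ n ≥ N, v n ≠ a := eventually_atTop.mp hev
  have hcount : ∀ n ≥ N, (window v 0 n).count a = (window v 0 N).count a := by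
    intro n hn
    induction n, hn using Nat.le_induction with
    | base => rfl
    | succ n hn ih =>
      rw [window_succ_right, zero_add, List.count_append, ih, Nat.add_eq_left, List.count_eq_zero,
        List.mem_singleton]
      exact (hN n hn).symm
  have hzero : HasLetterFreq v a 0 :=
    (tendsto_const_div_atTop_nhds_zero_nat ((window v 0 N).count a : ℝ)).congr' <| by
      filter_upwards [eventually_ge_atTop N] with n hn
      rw [hcount n hn]
  exact hne (tendsto_nhds_unique hθ hzero)

theorem HasSparseRepetitions.mul_freq_le_one {m : ℕ} (hv : HasSparseRepetitions v m)
    (hθ : HasLetterFreq v a θ) : m * θ ≤ 1 :=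
  hθ.mul_le_of_count_le fun i => by
    exact_mod_cast List.nodup_iff_count_le_one.mp (hv.distinctWithin.nodup_window i) a

theorem HasLetterFreq.one_le_mul_of_recursAt (hbal : IsBalanced v) (hθ : HasLetterFreq v a θ)
    {g : ℕ} (hg : 0 < g) (ha : RecursAt v g a) : 1 ≤ (g + 1) * θ := by
  have := hθ.le_mul_of_le_count (n := g + 1) (c := 1) fun j => by
    exact_mod_cast List.count_pos_iff.mpr (hbal.mem_window hg ha j)
  exact_mod_cast this

/-- The excess of the number of occurrences of `a` before position `n` over the number `n * θ`
expected at frequency `θ`. -/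
def discrepancy (v : ℕ → α) (a : α) (θ : ℝ) (n : ℕ) : ℝ :=
  (window v 0 n).count a - n * θ

theorem discrepancy_add (v : ℕ → α) (a : α) (θ : ℝ) (i n : ℕ) :
    discrepancy v a θ (i + n) =
      discrepancy v a θ i + ((window v i n).count a - n * θ) := by
  simp only [discrepancy, window_add, List.count_append, zero_add]
  push_cast
  ring

theorem HasLetterFreq.abs_discrepancy_sub_le (hbal : IsBalanced v) (hθ : HasLetterFreq v a θ)
    (i j : ℕ) : |discrepancy v a θ i - discrepancy v a θ j| ≤ 1 := by
  wlog hij : j ≤ i generalizing i j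
  · rw [abs_sub_comm]
    exact this j i (Nat.le_of_not_le hij)
  obtain ⟨n, rfl⟩ := Nat.exists_eq_add_of_le hij
  rw [discrepancy_add, add_sub_cancel_left, abs_sub_le_iff]
  constructor
  · rw [sub_le_iff_le_add', ← sub_le_iff_le_add]
    refine hθ.le_mul_of_le_count fun k => ?_
    rw [sub_le_iff_le_add]
    exact_mod_cast hbal.count_window_le a j k n
  · rw [sub_le_iff_le_add']
    exact hθ.mul_le_of_count_le fun k => by exact_mod_cast hbal.count_window_le a k j n

theorem HasLetterFreq.eventually_count_eq (hbal : IsBalanced v) (hθ : HasLetterFreq v a θ) {q : ℕ}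
    {p : ℤ} (hqp : q * θ = p) : ∀ᶠ n in atTop, ((window v n q).count a : ℤ) = p := by
  have hzero : ∀ᶠ n in atTop, ((window v n q).count a : ℤ) - p = 0 := by
    refine eventually_eq_zero_of_abs_sum_range_le (C := q) (fun i j => ?_) fun n => ?_
    · have := hbal.count_window_le a i j q
      lia
    · have hsum := abs_sum_range_shift_sub_le (hθ.abs_discrepancy_sub_le hbal) q n
      simp only [add_comm q, discrepancy_add, add_sub_cancel_left, hqp, mul_one] at hsum
      exact_mod_cast hsum
  exact hzero.mono fun n => sub_eq_zero.mp

theorem HasLetterFreq.exists_eventually_periodic (hbal : IsBalanced v) (hθ : HasLetterFreq v a θ)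
    (hrat : ¬ Irrational θ) :
    ∃ q > 0, ∀ᶠ n in atTop, v (n + q) = a ↔ v n = a := by
  obtain ⟨x, rfl⟩ := not_not.mp hrat
  have hqp : x.den * (x : ℝ) = x.num := by exact_mod_cast Rat.den_mul_eq_num x
  have hcount := hθ.eventually_count_eq hbal hqp
  refine ⟨x.den, x.den_pos, ?_⟩
  filter_upwards [hcount, (tendsto_add_atTop_nat 1).eventually hcount] with n hn hn'
  have h := congrArg (List.count a) ((window_succ v n x.den).symm.trans (window_succ_right v n _))
  rw [List.count_cons, List.count_append, List.count_singleton] at h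
  simp only [beq_iff_eq] at h
  split_ifs at h <;> first | tauto | lia

/-! ### Constant progressions -/

theorem denseRange_discrepancy_progression (v : ℕ → α) (a : α) (hθ : Irrational θ) {P : ℕ}
    (hP : 0 < P) (r : ℕ) :
    DenseRange fun j : ℕ => (discrepancy v a θ (r + j * P) : UnitAddCircle) := by
  have hrot : DenseRange fun j : ℕ => j • ((-(P * θ) : ℝ) : UnitAddCircle) := by
    rw [← denseRange_zsmul_iff_nsmul, AddCircle.denseRange_zsmul_coe_iff, div_one]
    exact (hθ.natCast_mul hP.ne').neg
  have htranslate := (Homeomorph.addLeft ((-(r * θ) : ℝ) : UnitAddCircle)).surjective.denseRange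
  convert htranslate.comp hrot (Homeomorph.continuous _) using 2 with j
  change _ = ((-(r * θ) : ℝ) : UnitAddCircle) + j • ((-(P * θ) : ℝ) : UnitAddCircle)
  rw [← AddCircle.coe_nsmul, ← AddCircle.coe_add, ← sub_eq_zero, ← AddCircle.coe_sub,
    AddCircle.coe_eq_zero_iff]
  refine ⟨(window v 0 (r + j * P)).count a, ?_⟩
  simp only [discrepancy, zsmul_eq_mul, nsmul_eq_mul]
  push_cast
  ring

theorem HasLetterFreq.not_irrational_of_progression (hbal : IsBalanced v)
    (hθ : HasLetterFreq v a θ) {r P : ℕ} (hP : 0 < P) {y : α} (hy : ∀ j, v (r + j * P) = y) :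
    ¬ Irrational θ := by
  intro hirr
  set D := discrepancy v a θ
  set δ : ℝ := ([y].count a : ℤ) - θ with hδ
  have hstep (j : ℕ) : D (r + j * P + 1) = D (r + j * P) + δ := by
    simp only [D, discrepancy_add, window_one, hy, hδ]
    push_cast
    ring
  have hδ_pos : 0 < |δ| := abs_pos.mpr (sub_ne_zero.mpr (hirr.ne_int _).symm)
  obtain ⟨i, j, hij⟩ := exists_lt_abs_sub_of_denseRange_coe
    (denseRange_discrepancy_progression v a hirr hP r) (sub_lt_self 1 hδ_pos)
  have hi := hθ.abs_discrepancy_sub_le hbal (r + i * P + 1) (r + j * P)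
  have hj := hθ.abs_discrepancy_sub_le hbal (r + j * P + 1) (r + i * P)
  change |D _ - D _| ≤ 1 at hi hj
  change 1 - |δ| < |D _ - D _| at hij
  rw [hstep] at hi hj
  grind

theorem IsBalanced.exists_eventually_periodic_of_progression [Finite α] (hbal : IsBalanced v)
    {r P : ℕ} (hP : 0 < P) {y : α} (hy : ∀ j, v (r + j * P) = y) :
    ∃ q > 0, ∀ᶠ n in atTop, v (n + q) = v n := by
  have hletter (a : α) : ∃ q > 0, ∀ᶠ n in atTop, v (n + q) = a ↔ v n = a := by
    obtain ⟨θ, hθ⟩ := hbal.exists_hasLetterFreq a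
    exact hθ.exists_eventually_periodic hbal (hθ.not_irrational_of_progression hbal hP hy)
  choose q hq hper using hletter
  obtain ⟨N, hN⟩ := eventually_atTop.mp (eventually_all.mpr hper)
  have hmul (a : α) (k n : ℕ) (hn : N ≤ n) : v (n + k * q a) = a ↔ v n = a := by
    induction k with
    | zero => simp
    | succ k ih => rw [Nat.succ_mul, ← add_assoc, hN _ (by lia), ih]
  have := Fintype.ofFinite α
  refine ⟨∏ a, q a, prod_pos fun a _ => hq a, eventually_atTop.mpr ⟨N, fun n hn => ?_⟩⟩
  obtain ⟨k, hk⟩ := dvd_prod_of_mem q (mem_univ (v n))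
  rw [hk, mul_comm]
  exact (hmul (v n) k n hn).mpr rfl

theorem HasSparseRepetitions.not_progression [Finite α] {m : ℕ} (hv : HasSparseRepetitions v m)
    (hbal : IsBalanced v) (hm : 0 < m) {r P : ℕ} (hP : 0 < P) {y : α} :
    ¬ ∀ j, v (r + j * P) = y := by
  intro hy
  obtain ⟨q, hq, hper⟩ := hbal.exists_eventually_periodic_of_progression hP hy
  exact hv.not_eventually_periodic hm hq hper

theorem HasSparseRepetitions.irrational_freq [Finite α] {m : ℕ} (hv : HasSparseRepetitions v m)
    (hbal : IsBalanced v) (hm : 0 < m) (hθ : HasLetterFreq v a θ) (hne : θ ≠ 0) :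
    Irrational θ := by
  by_contra hrat
  obtain ⟨q, hq, hper⟩ := hθ.exists_eventually_periodic hbal hrat
  obtain ⟨N, hN⟩ := eventually_atTop.mp hper
  obtain ⟨r, hr, hra⟩ := frequently_atTop.mp (hθ.frequently_eq hne) N
  refine hv.not_progression hbal hm hq (r := r) (y := a) fun j => ?_
  induction j with
  | zero => simpa using hra
  | succ j ih => rwa [Nat.succ_mul, ← add_assoc, hN _ (by lia)]

end Frequency

/-! ### Sequences whose letters recur only at distances exceeding `m` -/

/-- The letter at position `t` recurs `m + 1` positions later, the least possible distance when any
`m + 1` consecutive letters are distinct. The Pansiot code of `v` has `0` at such `t` and `1`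
elsewhere. -/
def ShortGap (v : ℕ → α) (m t : ℕ) : Prop :=
  v (t + m + 1) = v t

/-- The letter `x` has a short gap somewhere in `v`. -/
def IsShort (v : ℕ → α) (m : ℕ) (x : α) : Prop :=
  RecursAt v (m + 1) x

theorem ShortGap.isShort {m t : ℕ} (h : ShortGap v m t) : IsShort v m (v t) :=
  ⟨t, rfl, h⟩

/-- A balanced sequence over `m + 2` letters whose Pansiot code is defined (any `m + 1` consecutive
letters are distinct) and avoids `00` and `111` (no word of length two recurs too soon). -/
structure IsBalancedPansiot [Fintype α] [DecidableEq α] (v : ℕ → α) (m : ℕ) : Prop where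
  pos : 0 < m
  card_eq : Fintype.card α = m + 2
  balanced : IsBalanced v
  distinct : DistinctWithin v (m + 1)
  pair_ne : ∀ ⦃t p⦄, 0 < p → p ≤ m + 2 → window v t 2 ≠ window v (t + p) 2

namespace IsBalancedPansiot

variable [Fintype α] [DecidableEq α] {m t : ℕ}

theorem ne_succ_of_eq (hv : IsBalancedPansiot v m) {p : ℕ} (hp : 0 < p) (hpm : p ≤ m + 2)
    (h : v (t + p) = v t) : v (t + p + 1) ≠ v (t + 1) := by
  intro h'
  refine hv.pair_ne (t := t) hp hpm (window_eq_window_iff.mpr fun k hk => ?_)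
  interval_cases k
  exacts [h.symm, h'.symm]

theorem not_shortGap_succ (hv : IsBalancedPansiot v m) (h : ShortGap v m t) :
    ¬ ShortGap v m (t + 1) := by
  have := hv.ne_succ_of_eq m.succ_pos (by lia) h
  rwa [ShortGap, show t + 1 + m + 1 = t + (m + 1) + 1 by lia]

theorem mem_window_of_not_shortGap (hv : IsBalancedPansiot v m) (h : ¬ ShortGap v m t) (x : α) :
    x ∈ window v t (m + 2) := by
  refine mem_of_nodup_of_card_le_length ?_ (by rw [length_window, hv.card_eq]) x
  rw [window_succ, List.nodup_cons, mem_window]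
  refine ⟨?_, hv.distinct.nodup_window (t + 1)⟩
  rintro ⟨k, hk, hkt⟩
  rcases (Nat.lt_succ_iff.mp hk).lt_or_eq with hkm | rfl
  · exact hv.distinct (by lia) (by lia) hkt.symm
  · exact h (by rwa [ShortGap, add_right_comm])

theorem apply_add_two_of_not_shortGap (hv : IsBalancedPansiot v m) (h₀ : ¬ ShortGap v m t)
    (h₁ : ¬ ShortGap v m (t + 1)) : v (t + m + 2) = v t := by
  obtain ⟨k, hk, hkt⟩ := mem_window.mp (hv.mem_window_of_not_shortGap h₀ (v (t + m + 2)))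
  obtain rfl | rfl | hk₂ : k = 0 ∨ k = 1 ∨ 2 ≤ k := by lia
  · exact hkt.symm
  · exact absurd (by rw [ShortGap, hkt]; congr 1; lia) h₁
  · exact absurd hkt (hv.distinct (by lia) (by lia))

theorem apply_add_three_of_shortGap (hv : IsBalancedPansiot v m) (h : ShortGap v m (t + 1)) :
    v (t + m + 3) = v t := by
  have h₀ : ¬ ShortGap v m t := fun h₀ => hv.not_shortGap_succ h₀ h
  have h₂ : ¬ ShortGap v m (t + 2) := hv.not_shortGap_succ h
  have hpos := hv.pos
  obtain ⟨k, hk, hkt⟩ := mem_window.mp (hv.mem_window_of_not_shortGap h₀ (v (t + m + 3)))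
  obtain rfl | rfl | rfl | hk₃ : k = 0 ∨ k = 1 ∨ k = 2 ∨ 3 ≤ k := by lia
  · exact hkt.symm
  · exact absurd (h.trans hkt) (hv.distinct (by lia) (by lia))
  · exact absurd (by rw [ShortGap, hkt]; congr 1; lia) h₂
  · exact absurd hkt (hv.distinct (by lia) (by lia))

theorem shortGap_of_not_shortGap (hv : IsBalancedPansiot v m) (h₀ : ¬ ShortGap v m t)
    (h₁ : ¬ ShortGap v m (t + 1)) : ShortGap v m (t + 2) := by
  by_contra h₂
  refine hv.ne_succ_of_eq (m + 1).succ_pos le_rfl (hv.apply_add_two_of_not_shortGap h₀ h₁) ?_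
  rw [← hv.apply_add_two_of_not_shortGap h₁ h₂]
  congr 1
  lia

theorem exists_ge_shortGap (hv : IsBalancedPansiot v m) (n : ℕ) : ∃ t ≥ n, ShortGap v m t := by
  by_contra! h
  exact h (n + 2) (by lia) (hv.shortGap_of_not_shortGap (h n le_rfl) (h (n + 1) (by lia)))

theorem not_isShort_of_shortGap_succ (hv : IsBalancedPansiot v m) (h : ShortGap v m (t + 1)) :
    ¬ IsShort v m (v t) := by
  have hpos := hv.pos
  intro hshort
  obtain ⟨k, hk, hkt⟩ :=
    InfWord.mem_window.mp (hv.balanced.mem_window m.succ_pos hshort (t + 1))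
  obtain hkm | rfl | rfl : k < m ∨ k = m ∨ k = m + 1 := by lia
  · exact hv.distinct (by lia) (by lia) hkt.symm
  · exact hv.not_shortGap_succ (by rwa [ShortGap, add_right_comm]) h
  · exact hv.distinct (by lia) (by lia) (hkt.symm.trans h)

theorem shortGap_succ_of_isShort (hv : IsBalancedPansiot v m) (h₀ : ¬ IsShort v m (v t))
    (h₁ : IsShort v m (v (t + 1))) : ShortGap v m (t + 1) := by
  by_contra hgap
  have hgap₀ : ¬ ShortGap v m t := fun h => h₀ h.isShort
  exact hv.not_isShort_of_shortGap_succ (hv.shortGap_of_not_shortGap hgap₀ hgap) h₁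

theorem isShort_of_isShort_isShort (hv : IsBalancedPansiot v m) (h₀ : IsShort v m (v t))
    (h₁ : IsShort v m (v (t + 1))) :
    IsShort v m (v (t + 3)) ∧ IsShort v m (v (t + m + 3)) ∧ IsShort v m (v (t + m + 4)) := by
  have hgap₁ : ¬ ShortGap v m (t + 1) := fun h => hv.not_isShort_of_shortGap_succ h h₀
  have hgap₂ : ¬ ShortGap v m (t + 2) := fun h => hv.not_isShort_of_shortGap_succ h h₁
  have hgap₃ : ShortGap v m (t + 3) := hv.shortGap_of_not_shortGap hgap₁ hgap₂
  refine ⟨hgap₃.isShort, ?_, ?_⟩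
  · rwa [show t + m + 3 = t + 1 + m + 2 by lia, hv.apply_add_two_of_not_shortGap hgap₁ hgap₂]
  · rw [show t + m + 4 = t + 3 + m + 1 by lia, hgap₃]
    exact hgap₃.isShort

theorem not_isShort_of_not_isShort_not_isShort (hv : IsBalancedPansiot v m)
    (h₂ : ¬ IsShort v m (v (t + 2))) (h₃ : ¬ IsShort v m (v (t + 3))) :
    ¬ IsShort v m (v (t + m + 3)) ∧ ¬ IsShort v m (v (t + m + 4)) := by
  have hgap₂ : ¬ ShortGap v m (t + 2) := fun h => h₂ h.isShort
  have hgap₃ : ¬ ShortGap v m (t + 3) := fun h => h₃ h.isShort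
  have hgap₁ : ShortGap v m (t + 1) := by
    by_contra hgap₁
    exact hgap₃ (hv.shortGap_of_not_shortGap hgap₁ hgap₂)
  constructor
  · rw [hv.apply_add_three_of_shortGap hgap₁]
    exact hv.not_isShort_of_shortGap_succ hgap₁
  · rwa [show t + m + 4 = t + 2 + m + 2 by lia, hv.apply_add_two_of_not_shortGap hgap₂ hgap₃]

/-- Two adjacent short letters reappear `m + 3` positions later, two adjacent non-short ones
`m + 1` positions later, so a pair of the second kind would be caught up by one of the first. -/
theorem isShort_or_isShort_of_isShort_isShort (hv : IsBalancedPansiot v m) {t : ℕ}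
    (h₀ : IsShort v m (v t)) (h₁ : IsShort v m (v (t + 1))) (k : ℕ) :
    IsShort v m (v (t + k)) ∨ IsShort v m (v (t + k + 1)) := by
  induction k using Nat.strong_induction_on generalizing t with
  | _ k ih =>
    obtain ⟨h₃, h₀', h₁'⟩ := hv.isShort_of_isShort_isShort h₀ h₁
    match k with
    | 0 => exact .inl h₀
    | 1 => exact .inl h₁
    | 2 => exact .inr h₃
    | 3 => exact .inl h₃
    | k + 4 =>
      by_contra! hlong
      obtain ⟨hk, hk'⟩ := hv.not_isShort_of_not_isShort_not_isShort (t := t + k + 2) hlong.1 hlong.2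
      have hnext := ih (k + 2) (by lia) h₀' h₁'
      rw [show t + m + 3 + (k + 2) = t + k + 2 + m + 3 by lia] at hnext
      exact hnext.elim hk hk'

theorem exists_progression_of_forall_not_isShort_isShort (hv : IsBalancedPansiot v m)
    (h : ∀ t, IsShort v m (v t) → ¬ IsShort v m (v (t + 1))) :
    ∃ r, ∀ j, v (r + j * (m + 1)) = v r := by
  obtain ⟨r, hr, hgap⟩ := hv.exists_ge_shortGap 1
  refine ⟨r, fun j => ?_⟩
  induction j with
  | zero => simp
  | succ j ih =>
    obtain ⟨u, hu⟩ := Nat.exists_eq_add_of_le' (hr.trans (r.le_add_right (j * (m + 1))))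
    have hshort : IsShort v m (v (u + 1)) := by
      rw [← hu, ih]
      exact hgap.isShort
    have hgap' := hv.shortGap_succ_of_isShort (fun h' => h u h' hshort) hshort
    rwa [← hu, ShortGap, ih, add_assoc, add_assoc, ← Nat.succ_mul] at hgap'

theorem exists_progression_of_isShort_isShort (hv : IsBalancedPansiot v m)
    (h₀ : IsShort v m (v t)) (h₁ : IsShort v m (v (t + 1))) :
    ∃ r, ∀ j, v (r + j * (m + 3)) = v r := by
  obtain ⟨s, hs, hgap⟩ := hv.exists_ge_shortGap (t + 1)
  obtain ⟨k, rfl⟩ := Nat.exists_eq_add_of_le' hs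
  rw [← add_assoc] at hgap
  refine ⟨k + t, fun j => ?_⟩
  induction j with
  | zero => simp
  | succ j ih =>
    have hlong : ¬ IsShort v m (v (k + t + j * (m + 3))) := by
      rw [ih]
      exact hv.not_isShort_of_shortGap_succ hgap
    have hshort : IsShort v m (v (k + t + j * (m + 3) + 1)) := by
      have := hv.isShort_or_isShort_of_isShort_isShort h₀ h₁ (k + j * (m + 3))
      rw [← add_assoc, add_comm t k] at this
      exact this.resolve_left hlong
    have hnext := hv.apply_add_three_of_shortGap (hv.shortGap_succ_of_isShort hlong hshort)
    rwa [ih, add_assoc, add_assoc, ← Nat.succ_mul] at hnext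

theorem exists_progression (hv : IsBalancedPansiot v m) :
    ∃ r P, 0 < P ∧ ∀ j, v (r + j * P) = v r := by
  by_cases h : ∃ t, IsShort v m (v t) ∧ IsShort v m (v (t + 1))
  · obtain ⟨t, h₀, h₁⟩ := h
    obtain ⟨r, hr⟩ := hv.exists_progression_of_isShort_isShort h₀ h₁
    exact ⟨r, m + 3, by lia, hr⟩
  · push Not at h
    obtain ⟨r, hr⟩ := hv.exists_progression_of_forall_not_isShort_isShort h
    exact ⟨r, m + 1, by lia, hr⟩

end IsBalancedPansiot

theorem HasSparseRepetitions.exists_recursAt [Fintype α] [DecidableEq α] {m : ℕ}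
    (hv : HasSparseRepetitions v m) (hbal : IsBalanced v) (hm : 3 ≤ m)
    (hcard : Fintype.card α = m + 2) : ∃ x, RecursAt v m x := by
  by_contra! hno
  have hpansiot : IsBalancedPansiot v m :=
    { pos := by lia
      card_eq := hcard
      balanced := hbal
      distinct := fun i j hij hj h => by
        rcases (Nat.lt_succ_iff.mp hj).lt_or_eq with hlt | rfl
        · exact hv.distinctWithin hij hlt h
        · exact hno (v i) ⟨i, rfl, h.symm⟩
      pair_ne := fun t p hp hpm h => by
        have := hv hp h
        lia }
  obtain ⟨r, P, hP, hr⟩ := hpansiot.exists_progression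
  exact hv.not_progression hbal (by lia) hP hr

end InfWord

open InfWord in
theorem proposition3p4_general {α : Type*} [Fintype α] [DecidableEq α] (d : ℕ) (hd : 5 ≤ d)
    (hcard : Fintype.card α = d) (v : ℕ → α) (hbal : IsBalanced v)
    (hE : critExp v ≤ ((((d : ℝ) - 1) / ((d : ℝ) - 2) : ℝ) : EReal)) :
    ∃ freq : α → ℝ, (∀ a, HasLetterFreq v a (freq a)) ∧
      ∃ ρ : ℝ, IsGreatest (Set.range freq) ρ ∧
        1 / ((d : ℝ) - 1) < ρ ∧ ρ < 1 / ((d : ℝ) - 2) := by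
  obtain ⟨m, rfl⟩ := Nat.exists_eq_add_of_le' (show 2 ≤ d by lia)
  have hd₁ : ((m + 2 : ℕ) : ℝ) - 1 = m + 1 := by push_cast; ring
  have hd₂ : ((m + 2 : ℕ) : ℝ) - 2 = m := by push_cast; ring
  rw [hd₁, hd₂] at hE ⊢
  have hm : 0 < m := by lia
  have hsparse := hasSparseRepetitions_of_critExp_le hm hE
  choose freq hfreq using hbal.exists_hasLetterFreq
  have : Nonempty α := ⟨v 0⟩
  obtain ⟨a, ha⟩ := Finite.exists_max freq
  obtain ⟨x, hx⟩ := hsparse.exists_recursAt hbal (by lia) hcard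
  have hlower : 1 / (m + 1 : ℝ) ≤ freq a :=
    ((div_le_iff₀' (by positivity)).mpr ((hfreq x).one_le_mul_of_recursAt hbal hm hx)).trans (ha x)
  have hupper : freq a ≤ 1 / (m : ℝ) :=
    (le_div_iff₀' (by positivity)).mpr (hsparse.mul_freq_le_one (hfreq a))
  have hirr : Irrational (freq a) :=
    hsparse.irrational_freq hbal hm (hfreq a) (lt_of_lt_of_le (by positivity) hlower).ne'
  refine ⟨freq, hfreq, freq a, ⟨⟨a, rfl⟩, Set.forall_mem_range.mpr ha⟩, ?_, ?_⟩
  · exact lt_of_le_of_ne hlower fun h => hirr ⟨1 / (m + 1), by rw [← h]; push_cast; rfl⟩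
  · exact lt_of_le_of_ne hupper fun h => hirr ⟨1 / m, by rw [h]; push_cast; rfl⟩

theorem proposition3p4 {α : Type*} [Fintype α] [DecidableEq α] (d : ℕ) (hd : 11 ≤ d)
    (hcard : Fintype.card α = d) (v : ℕ → α) (hbal : InfWord.IsBalanced v)
    (hE : InfWord.critExp v = ((((d : ℝ) - 1) / ((d : ℝ) - 2) : ℝ) : EReal)) :
    ∃ freq : α → ℝ, (∀ a, InfWord.HasLetterFreq v a (freq a)) ∧
      ∃ ρ : ℝ, IsGreatest (Set.range freq) ρ ∧
        1 / ((d : ℝ) - 1) < ρ ∧ ρ < 1 / ((d : ℝ) - 2) := by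
  exact proposition3p4_general d (by lia) hcard v hbal hE.le
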